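/- Let $D$ be a division ring and $F$ a subfield of its centre such that $d:=\dim_F D$ is finite. Let $U$ and $V$ be finite-dimensional right $D$-vector spaces, put $n:=\dim_D V$ and $\alpha(n,d):=n(d-1)+d\,\frac{n(n-1)}{2}$. *Operator spaces.* An $F$-linear subspace $S$ of $\mathrm{Hom}_D(U,V)$ is *intransitive* if $Sx:=\{f(x): f\in S\}\neq V$ for all $x\in U$. It is *deeply intransitive* if it is intransitive and, for every nonzero $D$-linear subspace $V'$ of $V$, the set of all $f\in S$ with $f(U)\subseteq V'$ is intransitive as an $F$-linear subspace of $\mathrm{Hom}_D(U,V')$. An *alternator* of $S$ is an $F$-bilinear form $b:U\times V\to F$ such that $b(x,f(x))=0$ for all $x\in U$, $f\in S$. A form $b$ on $U\times V$ (with values in $F$ or $D$) is *right-nondegenerate* if the only $y\in V$ with $b(x,y)=0$ for all $x\in U$ is $y=0$. We denote by $\mathcal A_{b,D}$ the set of all $f\in\mathrm{Hom}_D(U,V)$ such that $b(x,f(x))=0$ for all $x\in U$. *Quadratic type.* $D$ is *of quadratic type* over $F$ if one of the following holds: (i) $d=1$; (ii) $d=2$ and $D$ is a separable field extension of $F$;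 (iii) $d=4$ and $D$ is a quaternion algebra over $F$; (iv) $F$ has characteristic $2$, $d=2^m$ for some $m\ge 1$, and $D$ is a field with $x^2\in F$ for all $x\in D$. The *standard involution* $\sigma$ of $D$ is then the identity in cases (i) and (iv), the non-identity $F$-automorphism in case (ii), and the quaternionic conjugation in case (iii). An *associated pair* for $D$ over $F$ is a pair $(\sigma,e)$ where $\sigma$ is the standard involution and $e:D\to F$ is the following $F$-linear form: the trace of $D$ over $F$ in cases (i) and (ii), the reduced trace $x\mapsto x+\sigma(x)$ in case (iii), and an arbitrary nonzero $F$-linear form in case (iv). A *$\sigma$-sesquilinear form* on $U\times V$ is a biadditive map $B:U\times V\to D$ such that $B(xa,y)=\sigma(a)B(x,y)$ and $B(x,ya)=B(x,y)a$ for all $x\in U$, $y\in V$, $a\in D$. **Theorem.** Let $S$ be a deeply intransitive $F$-linear subspace of $\mathrm{Hom}_D(U,V)$. Assume that $|F|\ge nd$, that $S$ has a right-nondegenerate alternator $b$, and that $$\dim_F S\ \ge\ \alpha(n,d)-n+\max(4-d,2).$$ Then $D$ is of quadratic type over $F$; for every associated pair $(\sigma,e)$ for $D$ over $F$ there is a unique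 right-nondegenerate $\sigma$-sesquilinear form $B$ on $U\times V$ such that $b(x,y)=e(B(x,y))$ for all $(x,y)\in U\times V$; and $S\subseteq \mathcal A_{b,D}$. -/

import Mathlib

open MulOpposite
open scoped Quaternion

/-! Throughout, `D` is a division ring, finite-dimensional over a field `F` acting through the
centre of `D`. Right `D`-vector spaces are modules over `Dᵐᵒᵖ`: the vector `x · a` is `op a • x`. -/

namespace DeepIntransitive

/-- `α(n,d) = n (d - 1) + d n (n - 1) / 2`. -/
def alpha (n d : ℕ) : ℕ := n * (d - 1) + d * (n * (n - 1) / 2)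

section QuadraticType

variable (F D : Type*) [Field F] [DivisionRing D] [Algebra F D]

/-- `D` is a separable field extension of `F` of degree `2`. -/
def IsSeparableQuadratic : Prop :=
  Module.finrank F D = 2 ∧ (∀ x y : D, x * y = y * x) ∧ Algebra.IsSeparable F D

/-- `D` has a basis `1, i, j, k = i j` with `i² = a + b i`, `j² = c`, `j i = b j - k`, where
`b² + 4 a ≠ 0` and `c ≠ 0`. In every characteristic these are exactly the quaternion algebras
(central simple algebras of degree `4`); the two conditions exclude the degenerate cases. -/
def IsQuaternionAlgebra : Prop :=
  ∃ a b c : F, b ^ 2 + 4 * a ≠ 0 ∧ c ≠ 0 ∧ Nonempty (D ≃ₐ[F] ℍ[F,a,b,c])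

/-- `D` is a field in which every square belongs to `F`. -/
def IsHyperRadicial : Prop :=
  (∀ x y : D, x * y = y * x) ∧ ∀ x : D, ∃ c : F, x ^ 2 = algebraMap F D c

/-- Hyper-radicial extension of degree `2 ^ m`, `m ≥ 1`, in characteristic `2`. -/
def IsHyperRadicialType : Prop :=
  CharP F 2 ∧ (∃ m : ℕ, 1 ≤ m ∧ Module.finrank F D = 2 ^ m) ∧ IsHyperRadicial F D

/-- `D` is of quadratic type over `F`. -/
def IsQuadraticType : Prop :=
  Module.finrank F D = 1 ∨
  IsSeparableQuadratic F D ∨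
  (Module.finrank F D = 4 ∧ IsQuaternionAlgebra F D) ∨
  IsHyperRadicialType F D

variable {F D}

/-- The `F`-algebra antiautomorphism `σ` (applied to `a : D` as `σ (op a)`) is the quaternionic
conjugation, transported from a presentation of `D` as a quaternion algebra. -/
def IsQuaternionicConjugation (σ : Dᵐᵒᵖ ≃ₐ[F] D) : Prop :=
  ∃ a b c : F, b ^ 2 + 4 * a ≠ 0 ∧ c ≠ 0 ∧
    ∃ φ : D ≃ₐ[F] ℍ[F,a,b,c], ∀ x : D, φ (σ (op x)) = star (φ x)

/-- `σ` is the standard involution of the division algebra `D` of quadratic type over `F`. -/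
def IsStandardInvolution (σ : Dᵐᵒᵖ ≃ₐ[F] D) : Prop :=
  (Module.finrank F D = 1 ∧ ∀ x : D, σ (op x) = x) ∨
  (IsSeparableQuadratic F D ∧ ∃ x : D, σ (op x) ≠ x) ∨
  (Module.finrank F D = 4 ∧ IsQuaternionicConjugation σ) ∨
  (IsHyperRadicialType F D ∧ ∀ x : D, σ (op x) = x)

/-- `(σ, e)` is an associated pair for `D` over `F`: `D` is of quadratic type over `F`, `σ` is its
standard involution and `e` is the trace (the usual one in degree at most `2`, the reduced one for
quaternion algebras) in the separable types, and any nonzero linear form in the hyper-radicial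
type. -/
def IsAssociatedPair (σ : Dᵐᵒᵖ ≃ₐ[F] D) (e : D →ₗ[F] F) : Prop :=
  IsQuadraticType F D ∧ IsStandardInvolution σ ∧
  (((Module.finrank F D = 1 ∨ IsSeparableQuadratic F D) ∧
      ∀ x : D, e x = LinearMap.trace F D (LinearMap.mulLeft F x)) ∨
   ((Module.finrank F D = 4 ∧ IsQuaternionAlgebra F D) ∧
      ∀ x : D, algebraMap F D (e x) = x + σ (op x)) ∨
   (IsHyperRadicialType F D ∧ e ≠ 0))

end QuadraticType

/-- Right-nondegeneracy of a form on `U × V`: its right radical is zero. -/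
def RightNondegenerate {U V W : Type*} [Zero V] [Zero W] (b : U → V → W) : Prop :=
  ∀ y : V, (∀ x : U, b x y = 0) → y = 0

/-- `σ`-sesquilinear forms `B : U × V → D` on right `D`-vector spaces: biadditive maps with
`B (x · a) y = σ a * B x y` and `B x (y · a) = B x y * a`. -/
abbrev SesquilinearForm {F D : Type*} [Field F] [DivisionRing D] [Algebra F D]
    (σ : Dᵐᵒᵖ ≃ₐ[F] D) (U V : Type*) [AddCommGroup U] [Module Dᵐᵒᵖ U]
    [AddCommGroup V] [Module Dᵐᵒᵖ V] : Type _ :=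
  U →ₛₗ[(σ : Dᵐᵒᵖ →+* D)] (V →ₗ[Dᵐᵒᵖ] D)

section Operators

variable {F D U V : Type*} [Field F] [DivisionRing D] [Algebra F D]
  [AddCommGroup U] [Module F U] [Module Dᵐᵒᵖ U] [IsScalarTower F Dᵐᵒᵖ U]
  [AddCommGroup V] [Module F V] [Module Dᵐᵒᵖ V] [IsScalarTower F Dᵐᵒᵖ V]

/-- `S` is intransitive: `S x ≠ V` for every `x`. -/
def Intransitive (S : Submodule F (U →ₗ[Dᵐᵒᵖ] V)) : Prop :=
  ∀ x : U, {y : V | ∃ f ∈ S, f x = y} ≠ Set.univ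

/-- The operators in `S` that map into `V'`, seen as operators from `U` to `V'`. -/
def operatorsInto (S : Submodule F (U →ₗ[Dᵐᵒᵖ] V)) (V' : Submodule Dᵐᵒᵖ V) :
    Submodule F (U →ₗ[Dᵐᵒᵖ] V') where
  carrier := {g | V'.subtype ∘ₗ g ∈ S}
  add_mem' {f g} hf hg := by
    have h : V'.subtype ∘ₗ (f + g) = V'.subtype ∘ₗ f + V'.subtype ∘ₗ g := by
      ext; simp
    simpa only [Set.mem_ofPred_eq, h] using S.add_mem hf hg
  zero_mem' := by
    have h : V'.subtype ∘ₗ (0 : U →ₗ[Dᵐᵒᵖ] V') = 0 := by ext; simp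
    simp only [Set.mem_ofPred_eq, h, S.zero_mem]
  smul_mem' c f hf := by
    have h : V'.subtype ∘ₗ (c • f) = c • (V'.subtype ∘ₗ f) := by
      ext; simp
    simpa only [Set.mem_ofPred_eq, h] using S.smul_mem c hf

/-- Deep intransitivity of an `F`-linear subspace of `Hom_D(U,V)`. -/
def DeeplyIntransitive (S : Submodule F (U →ₗ[Dᵐᵒᵖ] V)) : Prop :=
  Intransitive S ∧ ∀ V' : Submodule Dᵐᵒᵖ V, V' ≠ ⊥ → Intransitive (operatorsInto S V')

/-- The `F`-bilinear form `b` on `U × V` is an alternator of `S`. -/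
def IsAlternator (S : Submodule F (U →ₗ[Dᵐᵒᵖ] V)) (b : U →ₗ[F] V →ₗ[F] F) : Prop :=
  ∀ x : U, ∀ f ∈ S, b x (f x) = 0

/-- The space `A_{b,D}` of all `D`-linear maps `f : U → V` with `b(x, f(x)) = 0` for all `x`. -/
def alternatingOperators (b : U →ₗ[F] V →ₗ[F] F) : Submodule F (U →ₗ[Dᵐᵒᵖ] V) where
  carrier := {f | ∀ x : U, b x (f x) = 0}
  add_mem' {f g} hf hg x := by
    simp only [Set.mem_ofPred_eq] at hf hg
    simp [hf x, hg x]
  zero_mem' x := by simp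
  smul_mem' c f hf x := by
    simp only [Set.mem_ofPred_eq] at hf
    simp [hf x]

end Operators

end DeepIntransitive

set_option linter.unusedSectionVars false
set_option linter.unusedVariables false

namespace DeepIntransitive

/-! ### Division algebras in which every element is quadratic over `F` -/

section Quadratic

variable {F D : Type*} [Field F] [DivisionRing D] [Algebra F D]

/-! Fix a nonzero linear form `e` on `D` and lift `b` to a `D`-valued `B`, linear in its second
variable, with `b = e ∘ B`. For a `D`-subspace `W` of `V` of dimension `k`, let `S_W` be the
operators of `S` with range in `W`. If `b x` is nonzero on `W`, an operator of `S_W` killing `x` has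
range in `W ∩ ker (B x)`, of dimension `k - 1`, while `S_W x` lies in `W ∩ ker (b x)`, of
`F`-dimension `kd - 1`. Summing `kd - 1` over the levels gives `dim S ≤ α(n,d)`. Unless `x` is
saturated, meaning that `S_W x` fills `W ∩ ker (b x)`, its level loses one more dimension. Since
`dim S ≥ α(n,d) - n + 2`, saturated vectors must exist.

Saturation is rigid: `w ↦ b(xa, wa)` vanishes wherever `b x` does on `W`, so it equals `q(a) b(x,
w)` there (`Saturated.exists_multiplier`). Transposing through `e` gives a linear `s` with `s 1 = 1`
and `a s(a) ∈ F`, so every element of `D` is quadratic; a classification then gives the quadratic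
type (`Saturated.isQuadraticType`). Given an associated pair, comparing `q` with the norm of `σ`
shows that `B` is `σ`-semilinear at saturated vectors (`Saturated.semilinearAt`). If semilinearity
failed somewhere on `V`, a descent through non-semilinear, hence unsaturated, vectors would force
`dim S ≤ α(n,d) - n + 1`. -/

theorem exists_linearForm_of_mem_range (g : D →ₗ[F] D)
    (hg : ∀ a, ∃ c : F, g a = algebraMap F D c) :
    ∃ t : D →ₗ[F] F, ∀ a, g a = algebraMap F D (t a) := by
  choose t ht using hg
  have inj := (algebraMap F D).injective
  exact ⟨{ toFun := t
           map_add' := fun a b => inj (by rw [map_add, ← ht, ← ht, ← ht, map_add])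
           map_smul' := fun c a => inj (by
            rw [← ht, map_smul, ht, Algebra.smul_def, RingHom.id_apply, smul_eq_mul, map_mul]) },
    ht⟩

/-- Every element of `D` is quadratic over `F`, with linear trace `t`, norm `q` and polar form `p`
of the norm. -/
structure QuadraticData (t : D →ₗ[F] F) (q : D → F) (p : D → D →ₗ[F] F) : Prop where
  trace_one : t 1 = 2
  mul_self : ∀ a, a * a = t a • a - q a • (1 : D)
  polar : ∀ a b, a * b + b * a = t a • b + t b • a - p a b • (1 : D)

/-- Polarizing `a * s a ∈ F` at the pair `(a, 1)` gives `a + s a ∈ F`, so `s a = t a - a`, and `a *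
(t a - a) = q a` is the quadratic equation of `a`. -/
theorem exists_quadraticData (s : D →ₗ[F] D) (h1 : s 1 = 1)
    (hs : ∀ a, ∃ c : F, a * s a = algebraMap F D c) :
    ∃ (t : D →ₗ[F] F) (q : D → F) (p : D → D →ₗ[F] F), QuadraticData t q p := by
  choose q hq using hs
  have hp : ∀ a b, ∃ c : F, a * s b + b * s a = algebraMap F D c := by
    intro a b
    refine ⟨q (a + b) - q a - q b, ?_⟩
    rw [map_sub, map_sub, ← hq, ← hq, ← hq, map_add, mul_add, add_mul, add_mul]
    abel
  obtain ⟨t, ht⟩ := exists_linearForm_of_mem_range (LinearMap.id + s) (by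
    intro a
    obtain ⟨c, hc⟩ := hp a 1
    exact ⟨c, by rw [← hc, h1]; simp⟩)
  have hp' : ∀ a, ∃ p : D →ₗ[F] F, ∀ b, a * s b + b * s a = algebraMap F D (p b) := fun a =>
    exists_linearForm_of_mem_range
      (LinearMap.mulLeft F a ∘ₗ s + LinearMap.mulRight F (s a)) (hp a)
  choose p hp' using hp'
  have hs' : ∀ a, s a = t a • (1 : D) - a := by
    intro a
    rw [← Algebra.algebraMap_eq_smul_one, ← ht]
    simp
  refine ⟨t, q, p, ?_, ?_, ?_⟩
  · apply (algebraMap F D).injective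
    rw [← ht]
    simp only [LinearMap.add_apply, LinearMap.id_apply, h1, one_add_one_eq_two, map_ofNat]
  · intro a
    rw [← Algebra.algebraMap_eq_smul_one (q a), ← hq, hs', mul_sub]
    simp
  · intro a b
    rw [← Algebra.algebraMap_eq_smul_one (p a b), ← hp', hs', hs', mul_sub, mul_sub]
    simp only [mul_smul_comm, mul_one]
    abel

namespace QuadraticData

variable {t : D →ₗ[F] F} {q : D → F} {p : D → D →ₗ[F] F}

theorem polar_one (h : QuadraticData t q p) (a : D) : p a 1 = t a := by
  have := h.polar a 1
  rw [h.trace_one, two_smul, mul_one, one_mul] at this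
  have h2 : (p a 1) • (1 : D) = t a • (1 : D) := by linear_combination (norm := module) this
  exact smul_left_injective F one_ne_zero h2

theorem polar_self (h : QuadraticData t q p) (a : D) : p a a = 2 * q a := by
  have h1 := h.polar a a
  rw [h.mul_self] at h1
  have h2 : (p a a) • (1 : D) = (2 * q a) • (1 : D) := by
    linear_combination (norm := module) h1
  exact smul_left_injective F one_ne_zero h2

theorem disc_sq (h : QuadraticData t q p) (a : D) :
    ((2 : F) • a - t a • (1 : D)) * ((2 : F) • a - t a • (1 : D)) =
      (t a ^ 2 - 4 * q a) • (1 : D) := by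
  simp only [mul_sub, sub_mul, smul_mul_assoc, mul_smul_comm, mul_one, one_mul, h.mul_self a]
  module

theorem eq_smul_one_of_disc_eq_zero (h : QuadraticData t q p) (h2 : (2 : F) ≠ 0) {a : D}
    (ha : t a ^ 2 - 4 * q a = 0) : a = (t a / 2) • (1 : D) := by
  have := h.disc_sq a
  rw [ha, zero_smul, mul_self_eq_zero] at this
  have h3 : (2 : F) • a = t a • (1 : D) := sub_eq_zero.mp this
  rw [div_eq_inv_mul, mul_smul, ← h3, smul_smul, inv_mul_cancel₀ h2, one_smul]

theorem trace_smul_one (h : QuadraticData t q p) (c : F) : t (c • (1 : D)) = 2 * c := by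
  rw [map_smul, h.trace_one, smul_eq_mul, mul_comm]

theorem norm_smul_one (h : QuadraticData t q p) (c : F) : q (c • (1 : D)) = c ^ 2 := by
  have h1 := h.mul_self (c • (1 : D))
  rw [h.trace_smul_one] at h1
  simp only [mul_smul_comm, mul_one] at h1
  have h2 : q (c • (1 : D)) • (1 : D) = (c ^ 2) • (1 : D) := by
    linear_combination (norm := module) h1
  exact smul_left_injective F one_ne_zero h2

theorem disc_smul_one (h : QuadraticData t q p) (c : F) :
    t (c • (1 : D)) ^ 2 - 4 * q (c • (1 : D)) = 0 := by
  rw [h.trace_smul_one, h.norm_smul_one]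
  ring

/-- An element of nonzero discriminant splits off the commutative subalgebra that it spans. -/
theorem exists_add (h : QuadraticData t q p) {i : D} (hi : t i ^ 2 - 4 * q i ≠ 0) (z : D) :
    ∃ x y : F, ∃ j : D, z = x • (1 : D) + y • i + j ∧ t j = 0 ∧ p i j = 0 := by
  set δ := t i ^ 2 - 4 * q i with hδ
  refine ⟨(t i * p i z - 2 * q i * t z) / δ, (t i * t z - 2 * p i z) / δ, _,
    (add_sub_cancel _ _).symm, ?_, ?_⟩
  · simp only [map_sub, map_add, map_smul, h.trace_one, smul_eq_mul]
    field_simp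
    rw [hδ]
    ring
  · simp only [map_sub, map_add, map_smul, h.polar_one, h.polar_self, smul_eq_mul]
    field_simp
    rw [hδ]
    ring

/-- Here `ab + ba` is always a scalar. If it is nonzero, then `a(ab) + (ab)a = a(ab + ba)` is a
scalar too, which makes `a` itself a scalar. -/
theorem mul_comm_of_trace_eq_zero (h : QuadraticData t q p) (h2 : (2 : F) = 0) (ht : t = 0)
    (a b : D) : a * b = b * a := by
  have h2' : ∀ z : D, z + z = 0 := fun z => by rw [← two_smul F, h2, zero_smul]
  have hab : ∀ a b : D, a * b + b * a = p a b • (1 : D) := by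
    intro a b
    rw [h.polar a b, ht]
    have := h2' (p a b • (1 : D))
    simp only [LinearMap.zero_apply, zero_smul, add_zero, zero_sub]
    exact neg_eq_of_add_eq_zero_left this
  by_cases hp : p a b = 0
  · have := hab a b
    rw [hp, zero_smul] at this
    rw [eq_neg_of_add_eq_zero_left this, eq_comm]
    exact eq_neg_of_add_eq_zero_left (h2' _)
  · have h3 : p a b • a = p a (a * b) • (1 : D) := by
      rw [← hab a (a * b), mul_assoc, ← mul_add, hab, mul_smul_comm, mul_one]
    have h4 : a = ((p a b)⁻¹ * p a (a * b)) • (1 : D) := by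
      rw [mul_smul, ← h3, smul_smul, inv_mul_cancel₀ hp, one_smul]
    rw [h4]
    simp

theorem isSeparableQuadratic (h : QuadraticData t q p) {i : D} (hi : t i ^ 2 - 4 * q i ≠ 0)
    (hspan : ∀ z : D, ∃ x y : F, z = x • (1 : D) + y • i) : IsSeparableQuadratic F D := by
  have hne : ∀ c : F, i ≠ c • (1 : D) := by
    rintro c rfl
    exact hi (h.disc_smul_one c)
  refine ⟨?_, ?_, ?_⟩
  · have hli : LinearIndependent F ![(1 : D), i] := by
      rw [LinearIndependent.pair_iff' one_ne_zero]
      exact fun c hc => hne c hc.symm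
    have hsp : ⊤ ≤ Submodule.span F (Set.range ![(1 : D), i]) := by
      intro z _
      obtain ⟨x, y, rfl⟩ := hspan z
      refine add_mem (Submodule.smul_mem _ _ (Submodule.subset_span ⟨0, rfl⟩))
        (Submodule.smul_mem _ _ (Submodule.subset_span ⟨1, rfl⟩))
    rw [Module.finrank_eq_card_basis (Module.Basis.mk hli hsp), Fintype.card_fin]
  · intro z w
    obtain ⟨x, y, rfl⟩ := hspan z
    obtain ⟨x', y', rfl⟩ := hspan w
    simp only [mul_add, add_mul, smul_mul_assoc, mul_smul_comm, mul_one, one_mul]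
    module
  · refine ⟨fun z => ?_⟩
    obtain ⟨x, y, rfl⟩ := hspan z
    by_cases hy : y = 0
    · rw [hy, zero_smul, add_zero, ← Algebra.algebraMap_eq_smul_one]
      exact isSeparable_algebraMap x
    · set z := x • (1 : D) + y • i with hz
      have hdisc : t z ^ 2 - 4 * q z = y ^ 2 * (t i ^ 2 - 4 * q i) := by
        have h1 := h.disc_sq z
        have h2 : (2 : F) • z - t z • (1 : D) = y • ((2 : F) • i - t i • (1 : D)) := by
          rw [hz, map_add, h.trace_smul_one, map_smul, smul_eq_mul]
          module
        rw [h2, smul_mul_smul_comm, h.disc_sq i, smul_smul] at h1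
        rw [← smul_left_injective F one_ne_zero h1]
        ring
      have hdz : t z ^ 2 - 4 * q z ≠ 0 := by
        rw [hdisc]
        exact mul_ne_zero (pow_ne_zero 2 hy) hi
      let P : Polynomial F := Polynomial.X ^ 2 - Polynomial.C (t z) * Polynomial.X
        + Polynomial.C (q z)
      have hPz : Polynomial.aeval z P = 0 := by
        simp only [P, map_add, map_sub, map_mul, Polynomial.aeval_X, Polynomial.aeval_C,
          pow_two, h.mul_self, Algebra.algebraMap_eq_smul_one, smul_mul_assoc, one_mul]
        module
      refine Polynomial.Separable.of_dvd ?_ (minpoly.dvd F z hPz)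
      -- Bézout relation from `P' ^ 2 - 4 P = t z ^ 2 - 4 q z`.
      refine ⟨Polynomial.C (-4 / (t z ^ 2 - 4 * q z)),
        Polynomial.C (1 / (t z ^ 2 - 4 * q z)) * (2 * Polynomial.X - Polynomial.C (t z)), ?_⟩
      have hder : Polynomial.derivative P = 2 * Polynomial.X - Polynomial.C (t z) := by
        simp [P, one_add_one_eq_two, map_ofNat Polynomial.C 2]
      have hC : (4 : Polynomial F) = Polynomial.C 4 := (map_ofNat _ 4).symm
      have e : Polynomial.C (1 / (t z ^ 2 - 4 * q z)) *
          (Polynomial.C (t z) ^ 2 - 4 * Polynomial.C (q z)) = 1 := by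
        rw [hC, ← Polynomial.C_pow, ← Polynomial.C_mul, ← Polynomial.C_sub, ← Polynomial.C_mul,
          one_div, inv_mul_cancel₀ hdz, Polynomial.C_1]
      have e2 : Polynomial.C (-4 / (t z ^ 2 - 4 * q z)) =
          -4 * Polynomial.C (1 / (t z ^ 2 - 4 * q z)) := by
        rw [hC, ← Polynomial.C_neg, ← Polynomial.C_mul]
        congr 1
        ring
      rw [hder, e2]
      simp only [P]
      linear_combination e

/-- Conjugation by `j` maps `i` to `t i - i ≠ i`. The centralizer of `i` is `K = F + F i`, and any
other `j'` with the properties of `j` has `j' j⁻¹` in it, whence `D = K + K j`. The sum is direct: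
otherwise `j` would lie in `K` and commute with `i`. -/
theorem isQuaternionAlgebra (h : QuadraticData t q p) {i j : D} (hi : t i ^ 2 - 4 * q i ≠ 0)
    (hj : j ≠ 0) (htj : t j = 0) (hpj : p i j = 0) :
    Module.finrank F D = 4 ∧ IsQuaternionAlgebra F D := by
  have hanti : ∀ j', t j' = 0 → p i j' = 0 → j' * i = t i • j' - i * j' := by
    intro j' h1 h2
    have := h.polar i j'
    rw [h1, h2, zero_smul, zero_smul, add_zero, sub_zero] at this
    exact eq_sub_of_add_eq' this
  have hjj : j * j = (-q j) • (1 : D) := by rw [h.mul_self, htj]; module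
  have hqj : -q j ≠ 0 := by
    intro h0
    rw [h0, zero_smul, mul_self_eq_zero] at hjj
    exact hj hjj
  let Q : QuaternionAlgebra.Basis D (-q i) (t i) (-q j) :=
    { i := i, j := j, k := i * j
      i_mul_i := by rw [h.mul_self]; module
      j_mul_j := hjj
      i_mul_j := rfl
      j_mul_i := hanti j htj hpj }
  have hdisc : (2 : F) • i - t i • (1 : D) ≠ 0 := by
    intro h0
    have := h.disc_sq i
    rw [h0, mul_zero, eq_comm, smul_eq_zero] at this
    exact this.elim hi one_ne_zero
  have hij : t i • (1 : D) - i = j * i * j⁻¹ := by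
    rw [hanti j htj hpj, sub_mul, smul_mul_assoc, mul_assoc, mul_inv_cancel₀ hj, mul_one]
  have hcent : ∀ z : D, z * i = i * z → ∃ x y : F, z = x • (1 : D) + y • i := by
    intro z hz
    obtain ⟨x, y, j', rfl, h1, h2⟩ := h.exists_add hi z
    refine ⟨x, y, ?_⟩
    have h3 : j' * i = i * j' := by
      simpa [add_mul, mul_add] using hz
    rw [hanti j' h1 h2] at h3
    have h4 : ((2 : F) • i - t i • (1 : D)) * j' = 0 := by
      rw [sub_mul, smul_mul_assoc, smul_mul_assoc, one_mul]
      linear_combination (norm := module) -h3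
    rw [(mul_eq_zero.mp h4).resolve_left hdisc, add_zero]
  have hsurj : ∀ z : D, ∃ x y u v : F,
      z = x • (1 : D) + y • i + (u • (1 : D) + v • i) * j := by
    intro z
    obtain ⟨x, y, j', rfl, h1, h2⟩ := h.exists_add hi z
    obtain ⟨u, v, huv⟩ := hcent (j' * j⁻¹) (by
      have h3 : i * j⁻¹ = j⁻¹ * (t i • (1 : D) - i) := by
        rw [hij, mul_assoc, inv_mul_cancel_left₀ hj]
      have h4 : j⁻¹ * i = (t i • (1 : D) - i) * j⁻¹ := by
        rw [sub_mul, smul_mul_assoc, one_mul, h3, mul_sub, mul_smul_comm, mul_one]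
        abel
      rw [mul_assoc, h4, ← mul_assoc, mul_sub, mul_smul_comm, mul_one, hanti j' h1 h2,
        sub_sub_cancel, mul_assoc])
    refine ⟨x, y, u, v, ?_⟩
    rw [← huv, inv_mul_cancel_right₀ hj]
  have hne : ∀ c : F, i ≠ c • (1 : D) := by
    rintro c rfl
    exact hi (h.disc_smul_one c)
  have hzero : ∀ x y : F, x • (1 : D) + y • i = 0 → x = 0 ∧ y = 0 := by
    intro x y hxy
    have hy : y = 0 := by
      by_contra hy
      refine hne (-(y⁻¹ * x)) ?_
      rw [neg_smul, mul_smul, eq_neg_of_add_eq_zero_left hxy, smul_neg, smul_smul,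
        inv_mul_cancel₀ hy, one_smul, neg_neg]
    rw [hy, zero_smul, add_zero, smul_eq_zero] at hxy
    exact ⟨hxy.resolve_right one_ne_zero, hy⟩
  have hlift : ∀ w : ℍ[F,-q i,t i,-q j], Q.liftHom w =
      w.re • (1 : D) + w.imI • i + (w.imJ • (1 : D) + w.imK • i) * j := by
    intro w
    simp only [QuaternionAlgebra.Basis.liftHom_apply, QuaternionAlgebra.Basis.lift, Q,
      Algebra.algebraMap_eq_smul_one, add_mul, smul_mul_assoc, one_mul]
    abel
  have hker : ∀ x y u v : F, x • (1 : D) + y • i + (u • (1 : D) + v • i) * j = 0 →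
      u • (1 : D) + v • i = 0 := by
    intro x y u v h0
    by_contra hne0
    set m := u • (1 : D) + v • i with hm
    set l := x • (1 : D) + y • i with hl
    have hcomm_m : m * i = i * m := by simp [hm, add_mul, mul_add]
    have hcomm_l : l * i = i * l := by simp [hl, add_mul, mul_add]
    have hmj : m * j = -l := eq_neg_of_add_eq_zero_right h0
    have hji : j * i = i * j := by
      apply mul_left_cancel₀ hne0
      rw [← mul_assoc, hmj, ← mul_assoc, hcomm_m, mul_assoc, hmj, neg_mul, mul_neg, hcomm_l]
    rw [hanti j htj hpj] at hji
    have h4 : ((2 : F) • i - t i • (1 : D)) * j = 0 := by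
      rw [sub_mul, smul_mul_assoc, smul_mul_assoc, one_mul]
      linear_combination (norm := module) -hji
    exact (mul_ne_zero hdisc hj) h4
  have hbij : Function.Bijective Q.liftHom := by
    constructor
    · rw [injective_iff_map_eq_zero]
      intro w hw
      rw [hlift] at hw
      have h1 := hker _ _ _ _ hw
      rw [h1, zero_mul, add_zero] at hw
      obtain ⟨h2, h3⟩ := hzero _ _ hw
      obtain ⟨h4, h5⟩ := hzero _ _ h1
      ext <;> assumption
    · intro z
      obtain ⟨x, y, u, v, rfl⟩ := hsurj z
      exact ⟨⟨x, y, u, v⟩, hlift _⟩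
  let φ : ℍ[F,-q i,t i,-q j] ≃ₐ[F] D := AlgEquiv.ofBijective Q.liftHom hbij
  refine ⟨?_, -q i, t i, -q j, ?_, hqj, ⟨φ.symm⟩⟩
  · rw [← φ.toLinearEquiv.finrank_eq, QuaternionAlgebra.finrank_eq_four]
  · rwa [mul_neg, ← sub_eq_add_neg]

/-- An element `i` of nonzero discriminant spans with `1` a commutative algebra, whose complement `t
= p i = 0` decides between quadratic and quaternion. If all discriminants vanish, `D = F` when `2 ≠
0`; in characteristic `2` the trace vanishes, so `D` is commutative with squares in `F`, hence
purely inseparable. -/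
theorem isQuadraticType [FiniteDimensional F D] (h : QuadraticData t q p) :
    IsQuadraticType F D := by
  by_cases hi : ∃ i, t i ^ 2 - 4 * q i ≠ 0
  · obtain ⟨i, hi⟩ := hi
    by_cases hj : ∃ j, j ≠ 0 ∧ t j = 0 ∧ p i j = 0
    · obtain ⟨j, hj, htj, hpj⟩ := hj
      exact Or.inr (Or.inr (Or.inl (h.isQuaternionAlgebra hi hj htj hpj)))
    · refine Or.inr (Or.inl (h.isSeparableQuadratic hi fun z => ?_))
      obtain ⟨x, y, j, rfl, h1, h2⟩ := h.exists_add hi z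
      by_cases h0 : j = 0
      · exact ⟨x, y, by rw [h0, add_zero]⟩
      · exact absurd ⟨j, h0, h1, h2⟩ hj
  · push Not at hi
    by_cases h2 : (2 : F) = 0
    · by_cases h1 : Module.finrank F D = 1
      · exact Or.inl h1
      have hchar : CharP F 2 := CharTwo.of_one_ne_zero_of_two_eq_zero one_ne_zero h2
      have ht : t = 0 := by
        ext a
        have h4 : (4 : F) = 0 := by rw [show (4 : F) = 2 * 2 by norm_num, h2, zero_mul]
        have := hi a
        rw [h4, zero_mul, sub_zero] at this
        simpa using this
      have hcomm := h.mul_comm_of_trace_eq_zero h2 ht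
      have hsq : ∀ x : D, ∃ c : F, x ^ 2 = algebraMap F D c := by
        intro x
        refine ⟨-q x, ?_⟩
        rw [pow_two, h.mul_self, ht, Algebra.algebraMap_eq_smul_one]
        simp
      have hpow : ∃ m : ℕ, Module.finrank F D = 2 ^ m := by
        let _ : Field D := { ‹DivisionRing D› with mul_comm := hcomm }
        have : ExpChar F 2 := ExpChar.prime Nat.prime_two
        have : IsPurelyInseparable F D := by
          rw [isPurelyInseparable_iff_pow_mem F 2]
          intro x
          obtain ⟨c, hc⟩ := hsq x
          exact ⟨1, c, by rw [pow_one, hc]⟩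
        exact IsPurelyInseparable.finrank_eq_pow F D 2
      obtain ⟨m, hm⟩ := hpow
      refine Or.inr (Or.inr (Or.inr ⟨hchar, ⟨m, ?_, hm⟩, hcomm, hsq⟩))
      rcases Nat.eq_zero_or_pos m with rfl | h0
      · exact absurd hm h1
      · exact h0
    · left
      exact finrank_eq_one (1 : D) one_ne_zero fun w =>
        ⟨t w / 2, (h.eq_smul_one_of_disc_eq_zero h2 (hi w)).symm⟩

end QuadraticData

end Quadratic

/-! ### The norm of the standard involution -/

section AssociatedPair

variable {F D : Type*} [Field F] [DivisionRing D] [Algebra F D]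

theorem IsQuaternionAlgebra.not_commutative (h : IsQuaternionAlgebra F D) :
    ¬ ∀ x y : D, x * y = y * x := by
  obtain ⟨a, b, c, hd, -, ⟨φ⟩⟩ := h
  intro hc
  have hc' : ∀ x y : ℍ[F,a,b,c], x * y = y * x := by
    intro x y
    apply φ.symm.injective
    rw [map_mul, map_mul, hc]
  have h1 := hc' ⟨0, 1, 0, 0⟩ ⟨0, 0, 1, 0⟩
  have h2 := congrArg QuaternionAlgebra.imJ h1
  have h3 := congrArg QuaternionAlgebra.imK h1
  simp at h2 h3
  have h4 : (2 : F) = 0 := by linear_combination h3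
  apply hd
  rw [← h2]
  linear_combination 2 * a * h4

theorem exists_eq_algebraMap_of_finrank_eq_one (h : Module.finrank F D = 1) (x : D) :
    ∃ c : F, x = algebraMap F D c := by
  obtain ⟨c, hc⟩ := (finrank_eq_one_iff_of_nonzero' (1 : D) one_ne_zero).mp h x
  exact ⟨c, by rw [← hc, Algebra.algebraMap_eq_smul_one]⟩

theorem commutative_of_finrank_eq_one (h : Module.finrank F D = 1) (x y : D) :
    x * y = y * x := by
  obtain ⟨c, rfl⟩ := exists_eq_algebraMap_of_finrank_eq_one h x
  exact Algebra.commutes c y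

theorem exists_span_of_finrank_eq_two (h : Module.finrank F D = 2) {i : D}
    (hi : ∀ c : F, i ≠ c • (1 : D)) (z : D) : ∃ x y : F, z = x • (1 : D) + y • i := by
  have hli : LinearIndependent F ![(1 : D), i] := by
    rw [LinearIndependent.pair_iff' one_ne_zero]
    exact fun c hc => hi c hc.symm
  have hsp := hli.span_eq_top_of_card_eq_finrank (by rw [Fintype.card_fin, h])
  have hz : z ∈ Submodule.span F (Set.range ![(1 : D), i]) := hsp ▸ Submodule.mem_top
  rw [Matrix.range_cons, Matrix.range_cons, Matrix.range_empty, Set.union_empty,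
    Set.singleton_union, Submodule.mem_span_pair] at hz
  obtain ⟨x, y, hxy⟩ := hz
  exact ⟨x, y, hxy.symm⟩

variable {σ : Dᵐᵒᵖ ≃ₐ[F] D} {e : D →ₗ[F] F}

theorem antiautomorphism_smul_one (c : F) : σ (op (c • (1 : D))) = c • (1 : D) := by
  rw [op_smul, map_smul, op_one, map_one]

theorem exists_norm_of_finrank_eq_two (h : Module.finrank F D = 2)
    (hc : ∀ x y : D, x * y = y * x) (hσ : ∃ x, σ (op x) ≠ x) (a : D) :
    ∃ N : F, σ (op a) * a = algebraMap F D N := by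
  obtain ⟨i, hi⟩ := hσ
  have hspan := exists_span_of_finrank_eq_two h (i := i) (by
    rintro c rfl
    exact hi (antiautomorphism_smul_one c))
  obtain ⟨m, s, hms⟩ := hspan (i * i)
  have hσi : σ (op i) * σ (op i) = m • (1 : D) + s • σ (op i) := by
    rw [← map_mul, ← op_mul, hms, op_add, map_add, antiautomorphism_smul_one, op_smul, map_smul]
  have hsum : σ (op i) + i = s • (1 : D) := by
    -- Both `i` and `σ i` are roots of `X² - sX - m`; subtracting the two equations gives this
    -- product.
    have h0 : (σ (op i) - i) * (σ (op i) + i - s • (1 : D)) = 0 := by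
      simp only [sub_mul, mul_sub, mul_add, hσi, hms, mul_smul_comm, mul_one]
      rw [hc i (σ (op i))]
      module
    exact sub_eq_zero.mp ((mul_eq_zero.mp h0).resolve_left (sub_ne_zero.mpr hi))
  have hσi' : σ (op i) = s • (1 : D) - i := eq_sub_of_add_eq hsum
  obtain ⟨x, y, rfl⟩ := hspan a
  refine ⟨x ^ 2 + x * y * s - y ^ 2 * m, ?_⟩
  rw [op_add, map_add, antiautomorphism_smul_one, op_smul, map_smul, hσi',
    Algebra.algebraMap_eq_smul_one]
  simp only [add_mul, mul_add, smul_sub, sub_mul, smul_mul_assoc, mul_smul_comm, mul_one, one_mul,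
    hms]
  module

theorem IsStandardInvolution.exists_norm (h : IsStandardInvolution σ) (a : D) :
    ∃ N : F, σ (op a) * a = algebraMap F D N := by
  rcases h with ⟨h, -⟩ | ⟨⟨h, hc, -⟩, hσ⟩ | ⟨-, A, B, C, -, -, φ, hφ⟩ | ⟨⟨-, -, -, h⟩, hσ⟩
  · exact exists_eq_algebraMap_of_finrank_eq_one h _
  · exact exists_norm_of_finrank_eq_two h hc hσ a
  · refine ⟨(star (φ a) * φ a).re, ?_⟩
    apply φ.injective
    rw [map_mul, hφ, AlgEquiv.commutes]
    exact QuaternionAlgebra.star_mul_eq_coe _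
  · obtain ⟨c, hc⟩ := h a
    exact ⟨c, by rw [hσ, ← pow_two, hc]⟩

theorem IsStandardInvolution.involutive_or_commutative (h : IsStandardInvolution σ) :
    (∀ x y : D, x * y = y * x) ∨ ∀ x, σ (op (σ (op x))) = x := by
  rcases h with ⟨h, -⟩ | ⟨⟨-, hc, -⟩, -⟩ | ⟨-, A, B, C, -, -, φ, hφ⟩ | ⟨⟨-, -, hc, -⟩, -⟩
  · exact Or.inl (commutative_of_finrank_eq_one h)
  · exact Or.inl hc
  · exact Or.inr fun x => φ.injective (by rw [hφ, hφ, star_star])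
  · exact Or.inl hc

/-- Immediate if `D` is commutative. For quaternions, `σ(a) c a` plus its conjugate is `σ(a) (c + σ
c) a`, and `c + σ c = e c` is central. -/
theorem IsAssociatedPair.map_norm_mul (h : IsAssociatedPair σ e) {a : D} {N : F}
    (hN : σ (op a) * a = algebraMap F D N) (c : D) : e (σ (op a) * c * a) = N * e c := by
  obtain ⟨-, hσ, he⟩ := h
  have comm_case : (∀ x y : D, x * y = y * x) → e (σ (op a) * c * a) = N * e c := by
    intro hc
    rw [mul_assoc, hc c a, ← mul_assoc, hN, ← Algebra.smul_def, map_smul, smul_eq_mul]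
  rcases hσ.involutive_or_commutative with hc | hinv
  · exact comm_case hc
  rcases he with ⟨h1 | h2, -⟩ | ⟨-, he⟩ | ⟨⟨-, -, hc, -⟩, -⟩
  · exact comm_case (commutative_of_finrank_eq_one h1)
  · exact comm_case h2.2.1
  · apply (algebraMap F D).injective
    have h1 : σ (op a) * a * algebraMap F D (e c) = σ (op a) * (c + σ (op c)) * a := by
      rw [mul_assoc, ← Algebra.commutes (e c) a, he c, mul_assoc]
    rw [he, map_mul, ← hN, h1, op_mul, op_mul, map_mul, map_mul, hinv, mul_add, add_mul,
      mul_assoc, mul_assoc]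
  · exact comm_case hc

theorem IsAssociatedPair.linearForm_ne_zero [FiniteDimensional F D] (h : IsAssociatedPair σ e) :
    e ≠ 0 := by
  obtain ⟨-, hσ, he⟩ := h
  rcases he with ⟨h1 | ⟨-, hc, hsep⟩, he⟩ | ⟨⟨h4, hq⟩, he⟩ | ⟨-, he⟩
  · intro h0
    have := he 1
    rw [h0, LinearMap.mulLeft_one, LinearMap.trace_id, h1] at this
    simp at this
  · let _ : Field D := { ‹DivisionRing D› with mul_comm := hc }
    obtain ⟨x, hx⟩ := Algebra.trace_surjective F D 1
    intro h0
    have h1 := he x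
    rw [h0] at h1
    exact zero_ne_one (h1.trans hx)
  · rcases hσ with ⟨h, -⟩ | ⟨⟨h, -⟩, -⟩ | ⟨-, A, B, C, hd, -, φ, hφ⟩ | ⟨⟨-, -, hc, -⟩, -⟩
    · omega
    · omega
    · rintro rfl
      have h0 : ∀ w : ℍ[F,A,B,C], w + star w = 0 := by
        intro w
        have := he (φ.symm w)
        rw [LinearMap.zero_apply, map_zero] at this
        have h2 := congrArg φ this
        rwa [map_zero, map_add, hφ, AlgEquiv.apply_symm_apply, eq_comm] at h2
      have h1 := congrArg QuaternionAlgebra.re (h0 1)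
      have h2 := congrArg QuaternionAlgebra.re (h0 ⟨0, 1, 0, 0⟩)
      simp at h1 h2
      apply hd
      rw [h2]
      linear_combination 2 * A * h1
    · exact absurd hc hq.not_commutative
  · exact he

end AssociatedPair

/-! ### The nondegenerate pairing `(z, c) ↦ e (z c)` and `D`-linear lifts -/

section LinearForms

variable {F D : Type*} [Field F] [DivisionRing D] [Algebra F D]

theorem eq_zero_of_forall_mul_right {e : D →ₗ[F] F} (he : e ≠ 0) {z : D}
    (h : ∀ c, e (z * c) = 0) : z = 0 := by
  by_contra hz
  refine he (LinearMap.ext fun c => ?_)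
  rw [← mul_inv_cancel_left₀ hz c, h, LinearMap.zero_apply]

theorem eq_zero_of_forall_mul_left {e : D →ₗ[F] F} (he : e ≠ 0) {z : D}
    (h : ∀ c, e (c * z) = 0) : z = 0 := by
  by_contra hz
  refine he (LinearMap.ext fun c => ?_)
  rw [← inv_mul_cancel_right₀ hz c, h, LinearMap.zero_apply]

variable [FiniteDimensional F D]

theorem exists_linearEquiv_mul_right {e : D →ₗ[F] F} (he : e ≠ 0) :
    ∃ M : D ≃ₗ[F] Module.Dual F D, ∀ z c, M z c = e (z * c) := by
  let M : D →ₗ[F] Module.Dual F D := (LinearMap.mul F D).compr₂ e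
  have hM : Function.Injective M := by
    rw [injective_iff_map_eq_zero]
    exact fun z hz => eq_zero_of_forall_mul_right he fun c => DFunLike.congr_fun hz c
  exact ⟨LinearEquiv.ofInjectiveOfFinrankEq M hM Subspace.dual_finrank_eq.symm, fun _ _ => rfl⟩

theorem exists_linearEquiv_mul_left {e : D →ₗ[F] F} (he : e ≠ 0) :
    ∃ M : D ≃ₗ[F] Module.Dual F D, ∀ z c, M z c = e (c * z) := by
  let M : D →ₗ[F] Module.Dual F D := (LinearMap.mul F D).flip.compr₂ e
  have hM : Function.Injective M := by
    rw [injective_iff_map_eq_zero]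
    exact fun z hz => eq_zero_of_forall_mul_left he fun c => DFunLike.congr_fun hz c
  exact ⟨LinearEquiv.ofInjectiveOfFinrankEq M hM Subspace.dual_finrank_eq.symm, fun _ _ => rfl⟩

theorem exists_linearForm_ne_zero : ∃ e : D →ₗ[F] F, e ≠ 0 := by
  by_contra! h
  refine one_ne_zero (α := D) ((Module.forall_dual_apply_eq_zero_iff F (1 : D)).mp fun e => ?_)
  rw [h e, LinearMap.zero_apply]

/-- For each `y`, the form `c ↦ φ (y c)` on `D` is `c ↦ e (z c)` for a unique `z`, which is `Φ y`.
-/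
theorem exists_lift {V : Type*} [AddCommGroup V] [Module F V] [Module Dᵐᵒᵖ V]
    [IsScalarTower F Dᵐᵒᵖ V] {e : D →ₗ[F] F} (he : e ≠ 0) (φ : V →ₗ[F] F) :
    ∃ Φ : V →ₗ[Dᵐᵒᵖ] D, ∀ y, e (Φ y) = φ y := by
  obtain ⟨M, hM⟩ := exists_linearEquiv_mul_right he
  let ψ : V → Module.Dual F D := fun y =>
    { toFun := fun c => φ (op c • y)
      map_add' := fun c c' => by rw [op_add, add_smul, map_add]
      map_smul' := fun r c => by rw [op_smul, smul_assoc, map_smul, RingHom.id_apply] }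
  have key : ∀ y c, e (M.symm (ψ y) * c) = φ (op c • y) := by
    intro y c
    rw [← hM, LinearEquiv.apply_symm_apply]
    rfl
  refine ⟨{ toFun := fun y => M.symm (ψ y), map_add' := fun y y' => ?_,
            map_smul' := fun a y => ?_ }, fun y => ?_⟩
  · rw [← sub_eq_zero]
    refine eq_zero_of_forall_mul_right he fun c => ?_
    rw [sub_mul, add_mul, map_sub, map_add, key, key, key, smul_add, map_add, sub_self]
  · obtain ⟨a, rfl⟩ := op_surjective a
    rw [← sub_eq_zero, RingHom.id_apply, op_smul_eq_mul]
    refine eq_zero_of_forall_mul_right he fun c => ?_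
    rw [sub_mul, map_sub, key, mul_assoc, key, op_mul, mul_smul, sub_self]
  · have := key y 1
    rwa [mul_one, op_one, one_smul] at this

end LinearForms

/-- Level `k + 1` contributes `(k + 1) d - 1`, the dimension of a hyperplane; stated additively to
avoid truncated subtraction. -/
theorem alpha_succ (k : ℕ) {d : ℕ} (hd : 0 < d) :
    alpha (k + 1) d + 1 = alpha k d + (k + 1) * d := by
  obtain ⟨d, rfl⟩ := Nat.exists_eq_succ_of_ne_zero hd.ne'
  rw [alpha, alpha, Nat.triangle_succ]
  generalize k * (k - 1) / 2 = m
  rw [Nat.succ_sub_one, Nat.succ_eq_add_one]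
  ring

/-! ### Filtration of `S` by ranges, and saturated vectors -/

section Operators

variable {F D U V : Type*} [Field F] [DivisionRing D] [Algebra F D]
  [AddCommGroup U] [Module F U] [Module Dᵐᵒᵖ U] [IsScalarTower F Dᵐᵒᵖ U]
  [AddCommGroup V] [Module F V] [Module Dᵐᵒᵖ V] [IsScalarTower F Dᵐᵒᵖ V]

/-- The operators in `S` with range included in `W`. -/
def operatorsWithin (S : Submodule F (U →ₗ[Dᵐᵒᵖ] V)) (W : Submodule Dᵐᵒᵖ V) :
    Submodule F (U →ₗ[Dᵐᵒᵖ] V) where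
  carrier := {f | f ∈ S ∧ ∀ x, f x ∈ W}
  add_mem' := fun hf hg => ⟨S.add_mem hf.1 hg.1, fun x => W.add_mem (hf.2 x) (hg.2 x)⟩
  zero_mem' := ⟨S.zero_mem, fun _ => W.zero_mem⟩
  smul_mem' := fun c _ hf => ⟨S.smul_mem c hf.1, fun x =>
    (W.restrictScalars F).smul_mem c (hf.2 x)⟩

/-- Evaluation of operators at a vector. -/
def evalAt (F : Type*) {D U V : Type*} [Field F] [DivisionRing D] [Algebra F D]
    [AddCommGroup U] [Module Dᵐᵒᵖ U] [AddCommGroup V] [Module F V] [Module Dᵐᵒᵖ V]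
    [IsScalarTower F Dᵐᵒᵖ V] (x : U) : (U →ₗ[Dᵐᵒᵖ] V) →ₗ[F] V where
  toFun f := f x
  map_add' _ _ := rfl
  map_smul' _ _ := rfl

theorem IsAlternator.swap {S : Submodule F (U →ₗ[Dᵐᵒᵖ] V)} {b : U →ₗ[F] V →ₗ[F] F}
    (hb : IsAlternator S b) {f : U →ₗ[Dᵐᵒᵖ] V} (hf : f ∈ S) (x y : U) :
    b x (f y) = - b y (f x) := by
  have h := hb (x + y) f hf
  simp only [map_add, LinearMap.add_apply, hb x f hf, hb y f hf] at h
  linear_combination h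

/-- `B` is the family of `D`-linear forms whose composites with `e` are the forms `b x`. -/
def IsLift (b : U →ₗ[F] V →ₗ[F] F) (e : D →ₗ[F] F) (B : U → V →ₗ[Dᵐᵒᵖ] D) : Prop :=
  ∀ x y, e (B x y) = b x y

variable {S : Submodule F (U →ₗ[Dᵐᵒᵖ] V)} {b : U →ₗ[F] V →ₗ[F] F} {e : D →ₗ[F] F}
  {B : U → V →ₗ[Dᵐᵒᵖ] D}

theorem IsLift.map_mul (hB : IsLift b e B) (x : U) (y : V) (c : D) :
    e (B x y * c) = b x (op c • y) := by
  rw [← hB, map_smul, op_smul_eq_mul]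

theorem IsLift.map_add (hB : IsLift b e B) (he : e ≠ 0) (x x' : U) (y : V) :
    B (x + x') y = B x y + B x' y := by
  rw [← sub_eq_zero]
  refine eq_zero_of_forall_mul_right he fun c => ?_
  rw [sub_mul, add_mul, map_sub, _root_.map_add, hB.map_mul, hB.map_mul, hB.map_mul,
    _root_.map_add, LinearMap.add_apply, sub_self]

theorem IsLift.map_smul (hB : IsLift b e B) (he : e ≠ 0) (r : F) (x : U) (y : V) :
    B (r • x) y = r • B x y := by
  rw [← sub_eq_zero]
  refine eq_zero_of_forall_mul_right he fun c => ?_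
  rw [sub_mul, smul_mul_assoc, map_sub, LinearMap.map_smul, hB.map_mul, hB.map_mul,
    LinearMap.map_smul b, LinearMap.smul_apply, sub_self]

/-- For every `c`, `e (B x (f y) c) = b(x, f(y c)) = -b(y c, f x) = 0`. -/
theorem apply_mem_ker_of_apply_eq_zero (hb : IsAlternator S b) (hB : IsLift b e B) (he : e ≠ 0)
    {f : U →ₗ[Dᵐᵒᵖ] V} (hf : f ∈ S) {x : U} (hx : f x = 0) (y : U) :
    f y ∈ LinearMap.ker (B x) := by
  rw [LinearMap.mem_ker]
  refine eq_zero_of_forall_mul_right he fun c => ?_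
  rw [hB.map_mul, ← LinearMap.map_smul, hb.swap hf, hx, LinearMap.map_zero, neg_zero]

variable [FiniteDimensional F D] [FiniteDimensional Dᵐᵒᵖ U] [FiniteDimensional Dᵐᵒᵖ V]

theorem finite_of_finite_opposite (F D V : Type*) [Field F] [DivisionRing D] [Algebra F D]
    [AddCommGroup V] [Module F V] [Module Dᵐᵒᵖ V] [IsScalarTower F Dᵐᵒᵖ V]
    [FiniteDimensional F D] [FiniteDimensional Dᵐᵒᵖ V] : FiniteDimensional F V := by
  have : FiniteDimensional F Dᵐᵒᵖ := Module.Finite.equiv (opLinearEquiv F)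
  exact Module.Finite.trans Dᵐᵒᵖ V

theorem finite_operators : FiniteDimensional F (U →ₗ[Dᵐᵒᵖ] V) := by
  have := finite_of_finite_opposite F D U
  have := finite_of_finite_opposite F D V
  exact Module.Finite.of_injective (LinearMap.restrictScalarsₗ F Dᵐᵒᵖ U V F)
    (LinearMap.restrictScalars_injective F)

theorem finrank_le_map_evalAt_add {T T' : Submodule F (U →ₗ[Dᵐᵒᵖ] V)} (x : U)
    (h : ∀ f ∈ T, f x = 0 → f ∈ T') :
    Module.finrank F T ≤ Module.finrank F (T.map (evalAt F x)) + Module.finrank F T' := by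
  have : FiniteDimensional F (U →ₗ[Dᵐᵒᵖ] V) := finite_operators
  have hrk := ((evalAt F x).domRestrict T).finrank_range_add_finrank_ker
  rw [LinearMap.range_domRestrict] at hrk
  rw [← hrk, ← Submodule.finrank_map_subtype_eq]
  gcongr
  apply Submodule.finrank_mono
  rintro _ ⟨f, hf, rfl⟩
  exact h f f.2 hf

theorem finrank_inf_ker_add {W : Submodule Dᵐᵒᵖ V} {Φ : V →ₗ[Dᵐᵒᵖ] D}
    (h : ∃ w ∈ W, Φ w ≠ 0) :
    Module.finrank F ((W ⊓ LinearMap.ker Φ).restrictScalars F) + Module.finrank F D =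
      Module.finrank F (W.restrictScalars F) := by
  have := finite_of_finite_opposite F D V
  obtain ⟨w, hw, hΦ⟩ := h
  let Ψ := (Φ.restrictScalars F).domRestrict (W.restrictScalars F)
  have hrange : LinearMap.range Ψ = ⊤ := by
    rw [LinearMap.range_eq_top]
    intro c
    refine ⟨⟨op ((Φ w)⁻¹ * c) • w, W.smul_mem _ hw⟩, ?_⟩
    simp [Ψ, mul_inv_cancel_left₀ hΦ]
  have hrk := Ψ.finrank_range_add_finrank_ker
  rw [hrange, finrank_top, add_comm, ← Submodule.finrank_map_subtype_eq] at hrk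
  suffices hker : (W ⊓ LinearMap.ker Φ).restrictScalars F =
      (LinearMap.ker Ψ).map (W.restrictScalars F).subtype by rw [← hrk, hker]
  ext y
  constructor
  · rintro ⟨h1, h2⟩
    exact ⟨⟨y, h1⟩, h2, rfl⟩
  · rintro ⟨y, hy, rfl⟩
    exact ⟨y.2, hy⟩

theorem finrank_operatorsWithin_le (hb : IsAlternator S b) (hB : IsLift b e B) (he : e ≠ 0)
    (W : Submodule Dᵐᵒᵖ V) (x : U) :
    Module.finrank F (operatorsWithin S W) ≤
      Module.finrank F ((operatorsWithin S W).map (evalAt F x)) +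
        Module.finrank F (operatorsWithin S (W ⊓ LinearMap.ker (B x))) :=
  finrank_le_map_evalAt_add x fun _ hf hx =>
    ⟨hf.1, fun y => ⟨hf.2 y, apply_mem_ker_of_apply_eq_zero hb hB he hf.1 hx y⟩⟩

theorem map_evalAt_operatorsWithin_le (hb : IsAlternator S b) (W : Submodule Dᵐᵒᵖ V) (x : U) :
    (operatorsWithin S W).map (evalAt F x) ≤ W.restrictScalars F ⊓ LinearMap.ker (b x) := by
  rintro _ ⟨f, hf, rfl⟩
  exact ⟨hf.2 x, hb x f hf.1⟩

/-- `x` is saturated in `W`: the operators in `S` with range in `W` take at `x` all the values in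
`W` that the alternator allows. -/
def Saturated (S : Submodule F (U →ₗ[Dᵐᵒᵖ] V)) (b : U →ₗ[F] V →ₗ[F] F)
    (W : Submodule Dᵐᵒᵖ V) (x : U) : Prop :=
  ∀ w ∈ W, b x w = 0 → ∃ f ∈ operatorsWithin S W, f x = w

theorem finrank_map_evalAt_add_two_le (hb : IsAlternator S b) {W : Submodule Dᵐᵒᵖ V} {x : U}
    (hx : ∃ w ∈ W, b x w ≠ 0) (hsat : ¬ Saturated S b W x) :
    Module.finrank F ((operatorsWithin S W).map (evalAt F x)) + 2 ≤
      Module.finrank F (W.restrictScalars F) := by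
  have := finite_of_finite_opposite F D V
  have h1 : (operatorsWithin S W).map (evalAt F x) <
      W.restrictScalars F ⊓ LinearMap.ker (b x) := by
    refine lt_of_le_of_ne (map_evalAt_operatorsWithin_le hb W x) fun heq => hsat ?_
    intro w hw hw0
    have : w ∈ (operatorsWithin S W).map (evalAt F x) := heq ▸ ⟨hw, hw0⟩
    exact this
  have h2 : W.restrictScalars F ⊓ LinearMap.ker (b x) < W.restrictScalars F := by
    refine lt_of_le_of_ne inf_le_left fun heq => ?_
    obtain ⟨w, hw, hw0⟩ := hx
    exact hw0 (inf_eq_left.mp heq hw)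
  have h3 := Submodule.finrank_lt_finrank_of_lt h1
  have h4 := Submodule.finrank_lt_finrank_of_lt h2
  omega

/-- If `b x w = 0`, saturation gives `w = f x`, so `b(xa, wa) = b(xa, f(xa)) = 0`. A linear form on
`W` vanishing on the kernel of `b x` is a multiple of it. -/
theorem Saturated.exists_multiplier (hb : IsAlternator S b) {W : Submodule Dᵐᵒᵖ V} {x : U}
    (hsat : Saturated S b W x) (hx : ∃ w ∈ W, b x w ≠ 0) (a : D) :
    ∃ q : F, ∀ w ∈ W, b (op a • x) (op a • w) = q * b x w := by
  obtain ⟨w₀, hw₀, hne⟩ := hx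
  refine ⟨b (op a • x) (op a • w₀) / b x w₀, fun w hw => ?_⟩
  have hmem : w - (b x w / b x w₀) • w₀ ∈ W :=
    (W.restrictScalars F).sub_mem hw ((W.restrictScalars F).smul_mem _ hw₀)
  obtain ⟨f, hf, hfx⟩ := hsat _ hmem (by
    rw [map_sub, map_smul, smul_eq_mul, div_mul_cancel₀ _ hne, sub_self])
  have h := hb (op a • x) f hf.1
  rw [LinearMap.map_smul f, hfx, smul_sub, smul_comm, map_sub, LinearMap.map_smul (b (op a • x)), smul_eq_mul, sub_eq_zero] at h
  rw [h]
  field_simp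

theorem IsLift.exists_apply_eq_one (hB : IsLift b e B) {W : Submodule Dᵐᵒᵖ V} {x : U}
    (hx : ∃ w ∈ W, b x w ≠ 0) : ∃ y ∈ W, B x y = 1 := by
  obtain ⟨w, hw, hne⟩ := hx
  have h0 : B x w ≠ 0 := fun h => hne (by rw [← hB, h, LinearMap.map_zero])
  exact ⟨op (B x w)⁻¹ • w, W.smul_mem _ hw, by
    rw [LinearMap.map_smul, op_smul_eq_mul, mul_inv_cancel₀ h0]⟩

theorem IsLift.exists_linearMap (hB : IsLift b e B) (he : e ≠ 0) (x : U) (y : V) :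
    ∃ l : D →ₗ[F] D, ∀ a, l a = B (op a • x) y :=
  ⟨{ toFun := fun a => B (op a • x) y
     map_add' := fun a a' => by rw [op_add, add_smul, hB.map_add he]
     map_smul' := fun r a => by rw [op_smul, smul_assoc, hB.map_smul he, RingHom.id_apply] },
    fun _ => rfl⟩

theorem Saturated.isQuadraticType (hb : IsAlternator S b) {W : Submodule Dᵐᵒᵖ V} {x : U}
    (hsat : Saturated S b W x) (hx : ∃ w ∈ W, b x w ≠ 0) : IsQuadraticType F D := by
  obtain ⟨e, he⟩ := exists_linearForm_ne_zero (F := F) (D := D)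
  choose B hB using fun x => exists_lift (D := D) he (b x)
  change IsLift b e B at hB
  obtain ⟨y, hy, hxy⟩ := hB.exists_apply_eq_one hx
  obtain ⟨l, hl⟩ := hB.exists_linearMap he x y
  choose q hq using hsat.exists_multiplier hb hx
  have hlq : ∀ a c, e (l a * c * a) = q a * e c := by
    intro a c
    rw [mul_assoc, hl, hB.map_mul, op_mul, mul_smul, hq a _ (W.smul_mem _ hy), ← hB.map_mul, hxy,
      one_mul]
  obtain ⟨M, hM⟩ := exists_linearEquiv_mul_right he
  obtain ⟨M', hM'⟩ := exists_linearEquiv_mul_left he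
  -- `s a` is `l a` moved to the other side of `c` under `e`, so `e (l a * c * a) = q a * e c`
  -- becomes `a * s a = q a`.
  let s : D →ₗ[F] D := M'.symm.toLinearMap ∘ₗ M.toLinearMap ∘ₗ l
  have hs : ∀ a c, e (c * s a) = e (l a * c) := by
    intro a c
    rw [← hM', ← hM]
    simp [s]
  obtain ⟨t, n, p, h⟩ := exists_quadraticData s (by
    rw [← sub_eq_zero]
    refine eq_zero_of_forall_mul_left he fun c => ?_
    rw [mul_sub, map_sub, hs, hl, op_one, one_smul, hxy, one_mul, mul_one, sub_self]) (by
    intro a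
    refine ⟨q a, ?_⟩
    rw [← sub_eq_zero]
    refine eq_zero_of_forall_mul_left he fun c => ?_
    rw [mul_sub, map_sub, ← mul_assoc, hs, ← mul_assoc, hlq, ← Algebra.commutes,
      ← Algebra.smul_def, map_smul, smul_eq_mul, sub_self])
  exact h.isQuadraticType

end Operators

/-! ### Semilinearity of the lift and dimension counts -/

section Operators

variable {F D U V : Type*} [Field F] [DivisionRing D] [Algebra F D]
  [AddCommGroup U] [Module F U] [Module Dᵐᵒᵖ U] [IsScalarTower F Dᵐᵒᵖ U]
  [AddCommGroup V] [Module F V] [Module Dᵐᵒᵖ V] [IsScalarTower F Dᵐᵒᵖ V]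
  [FiniteDimensional F D] [FiniteDimensional Dᵐᵒᵖ U] [FiniteDimensional Dᵐᵒᵖ V]
  {S : Submodule F (U →ₗ[Dᵐᵒᵖ] V)} {b : U →ₗ[F] V →ₗ[F] F} {e : D →ₗ[F] F}
  {B : U → V →ₗ[Dᵐᵒᵖ] D} {σ : Dᵐᵒᵖ ≃ₐ[F] D}

/-- The forms `B (x · a)` and `σ a * B x` agree on `W` for every scalar `a`. -/
def SemilinearAt (σ : Dᵐᵒᵖ ≃ₐ[F] D) (B : U → V →ₗ[Dᵐᵒᵖ] D) (W : Submodule Dᵐᵒᵖ V) (x : U) :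
    Prop :=
  ∀ a : D, ∀ w ∈ W, B (op a • x) w = σ (op a) * B x w

theorem eq_id_of_forall_smul (g : D →ₗ[F] D) (r : D → F) (h1 : g 1 = 1)
    (hg : ∀ a, a ≠ 0 → g a = r a • a) (a : D) : g a = a := by
  obtain ⟨μ, hμ⟩ := LinearMap.exists_eq_smul_id_of_forall_notLinearIndependent (f := g) (by
    intro v hv
    by_cases h0 : v = 0
    · exact hv.ne_zero 0 h0
    · rw [LinearIndependent.pair_iff' h0] at hv
      exact hv (r v) (hg v h0).symm)
  have h2 : μ • (1 : D) = 1 := by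
    rw [hμ] at h1
    exact h1
  rw [hμ, LinearMap.smul_apply, Module.End.one_apply, ← one_mul a, ← smul_mul_assoc, h2]

/-- The multiplier `q` of `x` and the norm `N` of `σ` obey the same identity, so `B (x a) = (q a / N
a) σ(a) B x` on `W`. Linearity in `a` forces the ratio to be `1`. -/
theorem Saturated.semilinearAt (hb : IsAlternator S b) (hσe : IsAssociatedPair σ e)
    (hB : IsLift b e B) {W : Submodule Dᵐᵒᵖ V} {x : U} (hsat : Saturated S b W x)
    (hx : ∃ w ∈ W, b x w ≠ 0) : SemilinearAt σ B W x := by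
  have he := hσe.linearForm_ne_zero
  obtain ⟨y, hy, hxy⟩ := hB.exists_apply_eq_one hx
  obtain ⟨l, hl⟩ := hB.exists_linearMap he x y
  choose q hq using hsat.exists_multiplier hb hx
  choose N hN using hσe.2.1.exists_norm
  have key : ∀ a : D, a ≠ 0 → ∀ w ∈ W,
      B (op a • x) w = (q a / N a) • (σ (op a) * B x w) := by
    intro a ha w hw
    have hN0 : N a ≠ 0 := by
      intro h0
      have := hN a
      rw [h0, map_zero] at this
      refine (mul_ne_zero ?_ ha) this
      rw [Ne, map_eq_zero_iff σ σ.injective, op_eq_zero_iff]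
      exact ha
    rw [← sub_eq_zero]
    refine eq_zero_of_forall_mul_right he fun c => ?_
    -- Writing the test scalar as `c * a` lets both multiplier identities apply.
    rw [← inv_mul_cancel_right₀ ha c]
    generalize c * a⁻¹ = c
    rw [sub_mul, map_sub, hB.map_mul, op_mul, mul_smul, hq a _ (W.smul_mem _ hw), ← hB.map_mul,
      smul_mul_assoc, map_smul, smul_eq_mul, ← mul_assoc, mul_assoc (σ (op a)),
      hσe.map_norm_mul (hN a), ← mul_assoc, div_mul_cancel₀ _ hN0, sub_self]
  -- `τ = σ⁻¹ ∘ l` has every nonzero vector as an eigenvector and fixes `1`, so it is the identity.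
  let τ : D →ₗ[F] D := (opLinearEquiv F).symm.toLinearMap ∘ₗ σ.symm.toLinearMap ∘ₗ l
  have hτ : ∀ a, σ (op (τ a)) = l a := by
    intro a
    simp [τ]
  have hτ1 : τ 1 = 1 := by
    apply op_injective
    apply σ.injective
    rw [hτ, hl, op_one, one_smul, hxy, map_one]
  have hτr : ∀ a, a ≠ 0 → τ a = (q a / N a) • a := by
    intro a ha
    apply op_injective
    apply σ.injective
    rw [hτ, hl, key a ha y hy, hxy, mul_one, op_smul, map_smul]
  intro a w hw
  by_cases ha : a = 0
  · rw [ha, op_zero, zero_smul, map_zero, zero_mul]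
    have := hB.map_smul he 0 0 w
    rwa [zero_smul, zero_smul] at this
  · have h1 : (q a / N a) • σ (op a) = σ (op a) := by
      rw [← map_smul, ← op_smul, ← hτr a ha, eq_id_of_forall_smul τ _ hτ1 hτr]
    rw [key a ha w hw, ← smul_mul_assoc, h1]

theorem exists_ne_zero_of_rightNondegenerate
    (hbr : RightNondegenerate (fun x y => b x y)) {W : Submodule Dᵐᵒᵖ V} {k : ℕ}
    (hW : Module.finrank F (W.restrictScalars F) = (k + 1) * Module.finrank F D) :
    ∃ x, ∃ w ∈ W, b x w ≠ 0 := by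
  by_contra! h
  have h0 : W.restrictScalars F = ⊥ := by
    rw [Submodule.eq_bot_iff]
    exact fun w hw => hbr w fun x => h x w hw
  rw [h0, finrank_bot] at hW
  exact (Nat.mul_pos k.succ_pos Module.finrank_pos).ne hW

theorem finrank_inf_ker {W : Submodule Dᵐᵒᵖ V} {x : U} {k : ℕ} (hB : IsLift b e B)
    (hW : Module.finrank F (W.restrictScalars F) = (k + 1) * Module.finrank F D)
    (hx : ∃ w ∈ W, b x w ≠ 0) :
    Module.finrank F ((W ⊓ LinearMap.ker (B x)).restrictScalars F) =
      k * Module.finrank F D := by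
  have h := finrank_inf_ker_add (F := F) (W := W) (Φ := B x) (by
    obtain ⟨w, hw, hne⟩ := hx
    exact ⟨w, hw, fun h => hne (by rw [← hB, h, LinearMap.map_zero])⟩)
  rw [hW, add_mul, one_mul] at h
  exact Nat.add_right_cancel h

theorem finrank_operatorsWithin_of_finrank_eq_zero {W : Submodule Dᵐᵒᵖ V}
    (hW : Module.finrank F (W.restrictScalars F) = 0) :
    Module.finrank F (operatorsWithin S W) = 0 := by
  have := finite_of_finite_opposite F D V
  rw [Submodule.finrank_eq_zero] at hW
  have : operatorsWithin S W = ⊥ := by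
    rw [Submodule.eq_bot_iff]
    intro f hf
    ext x
    have : f x ∈ W.restrictScalars F := hf.2 x
    rwa [hW, Submodule.mem_bot] at this
  rw [this, finrank_bot]

theorem finrank_operatorsWithin_succ_le (hb : IsAlternator S b) (hB : IsLift b e B) (he : e ≠ 0)
    {W : Submodule Dᵐᵒᵖ V} {x : U} {k m : ℕ}
    (hW : Module.finrank F (W.restrictScalars F) = (k + 1) * Module.finrank F D)
    (hx : ∃ w ∈ W, b x w ≠ 0) (hsat : ¬ Saturated S b W x)
    (hm : Module.finrank F (operatorsWithin S (W ⊓ LinearMap.ker (B x))) + k ≤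
      alpha k (Module.finrank F D) + m) :
    Module.finrank F (operatorsWithin S W) + (k + 1) ≤
      alpha (k + 1) (Module.finrank F D) + m := by
  have h1 := finrank_operatorsWithin_le hb hB he W x
  have h2 := finrank_map_evalAt_add_two_le hb hx hsat
  have h3 := alpha_succ k (Module.finrank_pos (R := F) (M := D))
  rw [hW] at h2
  omega

/-- Without saturated vectors there is a loss of at least one dimension at every level. -/
theorem finrank_operatorsWithin_add_le (hb : IsAlternator S b) (hB : IsLift b e B) (he : e ≠ 0)
    (hbr : RightNondegenerate (fun x y => b x y))
    (h : ∀ (W : Submodule Dᵐᵒᵖ V) (x : U), (∃ w ∈ W, b x w ≠ 0) → ¬ Saturated S b W x) (k : ℕ) :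
    ∀ W : Submodule Dᵐᵒᵖ V,
      Module.finrank F (W.restrictScalars F) = k * Module.finrank F D →
      Module.finrank F (operatorsWithin S W) + k ≤ alpha k (Module.finrank F D) := by
  induction k with
  | zero =>
    intro W hW
    rw [zero_mul] at hW
    rw [finrank_operatorsWithin_of_finrank_eq_zero hW]
    exact Nat.zero_le _
  | succ k ih =>
    intro W hW
    obtain ⟨x, hx⟩ := exists_ne_zero_of_rightNondegenerate hbr hW
    exact finrank_operatorsWithin_succ_le (m := 0) hb hB he hW hx (h W x hx)
      (ih _ (finrank_inf_ker hB hW hx))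

theorem SemilinearAt.add (hB : IsLift b e B) (he : e ≠ 0) {W : Submodule Dᵐᵒᵖ V} {x x' : U}
    (h : SemilinearAt σ B W x) (h' : SemilinearAt σ B W x') : SemilinearAt σ B W (x + x') := by
  intro a w hw
  rw [smul_add, hB.map_add he, hB.map_add he, h a w hw, h' a w hw, mul_add]

theorem SemilinearAt.neg (hB : IsLift b e B) (he : e ≠ 0) {W : Submodule Dᵐᵒᵖ V} {x : U}
    (h : SemilinearAt σ B W x) : SemilinearAt σ B W (-x) := by
  have hneg : ∀ x w, B (-x) w = - B x w := by
    intro x w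
    have := hB.map_smul he (-1) x w
    rwa [neg_one_smul, neg_one_smul] at this
  intro a w hw
  rw [smul_neg, hneg, hneg, h a w hw, mul_neg]

theorem not_semilinearAt_add (hB : IsLift b e B) (he : e ≠ 0) {W : Submodule Dᵐᵒᵖ V} {x x' : U}
    (h : ¬ SemilinearAt σ B W x) (h' : SemilinearAt σ B W x') :
    ¬ SemilinearAt σ B W (x + x') := by
  intro hs
  refine h ?_
  have := hs.add hB he (h'.neg hB he)
  rwa [add_neg_cancel_right] at this

/-- If all vectors are semilinear on `W ⊓ ker (B x₁)` whenever `x₁` is not semilinear on `W`, then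
these hyperplanes of `W` coincide. -/
theorem inf_ker_le_of_not_semilinearAt {W : Submodule Dᵐᵒᵖ V} {x₁ x₂ x : U}
    (hx : ¬ SemilinearAt σ B W x)
    (h₁ : ∀ z, SemilinearAt σ B (W ⊓ LinearMap.ker (B x₁)) z)
    (h₂ : ∀ z, SemilinearAt σ B (W ⊓ LinearMap.ker (B x₂)) z) {y : V} (hy : y ∈ W)
    (hy₂ : B x₂ y = 0) : B x₁ y = 0 := by
  by_contra hne
  refine hx fun a w hw => ?_
  set c := (B x₁ y)⁻¹ * B x₁ w with hc
  have hmem : w - op c • y ∈ W ⊓ LinearMap.ker (B x₁) := by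
    refine ⟨W.sub_mem hw (W.smul_mem _ hy), ?_⟩
    rw [SetLike.mem_coe, LinearMap.mem_ker, map_sub, map_smul, op_smul_eq_mul, hc, mul_inv_cancel_left₀ hne,
      sub_self]
  have e1 := h₁ x a _ hmem
  have e2 := h₂ x a (op c • y) ⟨W.smul_mem _ hy, by
    rw [SetLike.mem_coe, LinearMap.mem_ker, map_smul, hy₂, smul_zero]⟩
  rw [map_sub, map_sub, mul_sub, e2] at e1
  exact sub_left_injective e1

theorem exists_not_semilinearAt (hB : IsLift b e B) (he : e ≠ 0) {W : Submodule Dᵐᵒᵖ V}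
    (hx : ∃ x, ¬ SemilinearAt σ B W x) (hz : ∃ z, ∃ w ∈ W, b z w ≠ 0) :
    ∃ x, ¬ SemilinearAt σ B W x ∧ ∃ w ∈ W, b x w ≠ 0 := by
  obtain ⟨x, hx⟩ := hx
  obtain ⟨z, w, hw, hne⟩ := hz
  by_cases hxw : b x w = 0
  · by_cases hzs : SemilinearAt σ B W z
    · refine ⟨x + z, not_semilinearAt_add hB he hx hzs, w, hw, ?_⟩
      rwa [map_add, LinearMap.add_apply, hxw, zero_add]
    · exact ⟨z, hzs, w, hw, hne⟩
  · exact ⟨x, hx, w, hw, hxw⟩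

/-- If some vector is not semilinear on `W`, then there is a loss of at least one dimension at all
levels but one. -/
theorem finrank_operatorsWithin_add_le_succ (hb : IsAlternator S b) (hB : IsLift b e B)
    (he : e ≠ 0) (hbr : RightNondegenerate (fun x y => b x y))
    (h : ∀ (W : Submodule Dᵐᵒᵖ V) (x : U), (∃ w ∈ W, b x w ≠ 0) →
      Saturated S b W x → SemilinearAt σ B W x) (k : ℕ) :
    ∀ W : Submodule Dᵐᵒᵖ V,
      Module.finrank F (W.restrictScalars F) = k * Module.finrank F D →
      (∃ x, ¬ SemilinearAt σ B W x) →
      Module.finrank F (operatorsWithin S W) + k ≤ alpha k (Module.finrank F D) + 1 := by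
  induction k with
  | zero =>
    intro W hW _
    rw [zero_mul] at hW
    rw [finrank_operatorsWithin_of_finrank_eq_zero hW]
    exact Nat.zero_le _
  | succ k ih =>
    intro W hW hex
    have hnz := exists_ne_zero_of_rightNondegenerate hbr hW
    by_cases hstep : ∃ x₁, ¬ SemilinearAt σ B W x₁ ∧ (∃ w ∈ W, b x₁ w ≠ 0) ∧
        ∃ z, ¬ SemilinearAt σ B (W ⊓ LinearMap.ker (B x₁)) z
    · obtain ⟨x₁, hx₁, hne, hz⟩ := hstep
      exact finrank_operatorsWithin_succ_le hb hB he hW hne (fun hs => hx₁ (h W x₁ hne hs))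
        (ih _ (finrank_inf_ker hB hW hne) hz)
    · push Not at hstep
      obtain ⟨x₁, hx₁, hne⟩ := exists_not_semilinearAt hB he hex hnz
      -- When the descent stops, all non-semilinear vectors annihilate the same hyperplane of `W`.
      have hzero : ∀ y ∈ W ⊓ LinearMap.ker (B x₁), ∀ x, ¬ SemilinearAt σ B W x → B x y = 0 := by
        intro y hy x hx
        by_cases hxw : ∃ w ∈ W, b x w ≠ 0
        · exact inf_ker_le_of_not_semilinearAt hx (hstep x hx hxw) (hstep x₁ hx₁ hne) hy.1 hy.2
        · push Not at hxw
          refine eq_zero_of_forall_mul_right he fun c => ?_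
          rw [hB.map_mul]
          exact hxw _ (W.smul_mem _ hy.1)
      -- A semilinear `x` is the difference of the non-semilinear `x₁ + x` and `x₁`, so all of `U`
      -- annihilates that hyperplane. It is therefore zero and the descent can only stop at level
      -- one.
      have hbot : (W ⊓ LinearMap.ker (B x₁)).restrictScalars F = ⊥ := by
        rw [Submodule.eq_bot_iff]
        intro y hy
        refine hbr y fun x => ?_
        change b x y = 0
        rw [← hB]
        by_cases hx : SemilinearAt σ B W x
        · have h1 := hzero y hy _ (not_semilinearAt_add hB he hx₁ hx)
          rw [hB.map_add he, hzero y hy x₁ hx₁, zero_add] at h1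
          rw [h1, LinearMap.map_zero]
        · rw [hzero y hy x hx, LinearMap.map_zero]
      have hk := finrank_inf_ker hB hW hne
      rw [hbot, finrank_bot, eq_comm, Nat.mul_eq_zero] at hk
      have hk0 := hk.resolve_right (Module.finrank_pos (R := F) (M := D)).ne'
      subst hk0
      refine finrank_operatorsWithin_succ_le hb hB he hW hne (fun hs => hx₁ (h W x₁ hne hs)) ?_
      rw [finrank_operatorsWithin_of_finrank_eq_zero (by rw [hbot, finrank_bot])]
      exact Nat.zero_le _

theorem operatorsWithin_top : operatorsWithin S ⊤ = S :=
  Submodule.ext fun _ => ⟨fun h => h.1, fun h => ⟨h, fun _ => Submodule.mem_top⟩⟩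

theorem finrank_restrictScalars_top :
    Module.finrank F ((⊤ : Submodule Dᵐᵒᵖ V).restrictScalars F) =
      Module.finrank Dᵐᵒᵖ V * Module.finrank F D := by
  have := finite_of_finite_opposite F D V
  have : FiniteDimensional F Dᵐᵒᵖ := Module.Finite.equiv (opLinearEquiv F)
  rw [Submodule.restrictScalars_top, finrank_top, ← Module.finrank_mul_finrank F Dᵐᵒᵖ V,
    ← (opLinearEquiv F : D ≃ₗ[F] Dᵐᵒᵖ).finrank_eq, mul_comm]

theorem isQuadraticType_of_lt_finrank (hb : IsAlternator S b)
    (hbr : RightNondegenerate (fun x y => b x y))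
    (hdim : alpha (Module.finrank Dᵐᵒᵖ V) (Module.finrank F D) <
      Module.finrank F S + Module.finrank Dᵐᵒᵖ V) : IsQuadraticType F D := by
  obtain ⟨e, he⟩ := exists_linearForm_ne_zero (F := F) (D := D)
  choose B hB using fun x => exists_lift (D := D) he (b x)
  by_contra hq
  have h := finrank_operatorsWithin_add_le (B := B) hb hB he hbr
    (fun W x hx hs => hq (hs.isQuadraticType hb hx)) _ ⊤ finrank_restrictScalars_top
  rw [operatorsWithin_top] at h
  exact h.not_gt hdim

theorem existsUnique_sesquilinearForm (hb : IsAlternator S b)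
    (hbr : RightNondegenerate (fun x y => b x y))
    (hdim : alpha (Module.finrank Dᵐᵒᵖ V) (Module.finrank F D) + 1 <
      Module.finrank F S + Module.finrank Dᵐᵒᵖ V) (hσe : IsAssociatedPair σ e) :
    ∃! B : SesquilinearForm σ U V, RightNondegenerate (fun x y => B x y) ∧
      ∀ x y, b x y = e (B x y) := by
  have he := hσe.linearForm_ne_zero
  choose B hB using fun x => exists_lift (D := D) he (b x)
  change IsLift b e B at hB
  have hsemi : ∀ x, SemilinearAt σ B ⊤ x := by
    by_contra! hx
    have h := finrank_operatorsWithin_add_le_succ hb hB he hbr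
      (fun W x hx hs => hs.semilinearAt hb hσe hB hx) _ ⊤ finrank_restrictScalars_top hx
    rw [operatorsWithin_top] at h
    exact h.not_gt hdim
  refine ⟨{ toFun := B, map_add' := fun x x' => ?_, map_smul' := fun a x => ?_ },
    ⟨fun y hy => hbr y fun x => ?_, fun x y => (hB x y).symm⟩, fun B' hB' => ?_⟩
  · ext y
    exact hB.map_add he x x' y
  · ext y
    exact hsemi x (unop a) y Submodule.mem_top
  · change b x y = 0
    rw [← hB]
    have : B x y = 0 := hy x
    rw [this, LinearMap.map_zero]
  · ext x y
    change B' x y = B x y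
    rw [← sub_eq_zero]
    refine eq_zero_of_forall_mul_right he fun c => ?_
    rw [sub_mul, map_sub, hB.map_mul, hB'.2, map_smul, op_smul_eq_mul, sub_self]

end Operators

end DeepIntransitive

theorem mainTheorem5 {F D U V : Type*} [Field F] [DivisionRing D] [Algebra F D]
    [FiniteDimensional F D]
    [AddCommGroup U] [Module F U] [Module Dᵐᵒᵖ U] [IsScalarTower F Dᵐᵒᵖ U]
    [AddCommGroup V] [Module F V] [Module Dᵐᵒᵖ V] [IsScalarTower F Dᵐᵒᵖ V]
    [FiniteDimensional Dᵐᵒᵖ U] [FiniteDimensional Dᵐᵒᵖ V]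
    (n d : ℕ) (hn : n = Module.finrank Dᵐᵒᵖ V) (hd : d = Module.finrank F D)
    (S : Submodule F (U →ₗ[Dᵐᵒᵖ] V))
    (hS : DeepIntransitive.DeeplyIntransitive S)
    (hF : ((n * d : ℕ) : Cardinal) ≤ Cardinal.mk F)
    (b : U →ₗ[F] V →ₗ[F] F)
    (hb : DeepIntransitive.IsAlternator S b)
    (hbr : DeepIntransitive.RightNondegenerate (fun x y => b x y))
    (hdim : (DeepIntransitive.alpha n d : ℤ) - n + max (4 - (d : ℤ)) 2 ≤ Module.finrank F S) :
    DeepIntransitive.IsQuadraticType F D ∧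
    (∀ (σ : Dᵐᵒᵖ ≃ₐ[F] D) (e : D →ₗ[F] F), DeepIntransitive.IsAssociatedPair σ e →
      ∃! B : DeepIntransitive.SesquilinearForm σ U V,
        DeepIntransitive.RightNondegenerate (fun x y => B x y) ∧
        ∀ x y, b x y = e (B x y)) ∧
    S ≤ DeepIntransitive.alternatingOperators b := by
  subst hn hd
  have hdim' : DeepIntransitive.alpha (Module.finrank Dᵐᵒᵖ V) (Module.finrank F D) + 1 <
      Module.finrank F S + Module.finrank Dᵐᵒᵖ V := by
    -- The maximum is at least `2`, just enough to exceed `α(n,d) - n + 1`.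
    have := le_max_right (4 - (Module.finrank F D : ℤ)) 2
    omega
  exact ⟨DeepIntransitive.isQuadraticType_of_lt_finrank hb hbr (by omega),
    fun σ e hσe => DeepIntransitive.existsUnique_sesquilinearForm hb hbr hdim' hσe,
    fun f hf x => hb x f hf⟩
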